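/- Let $\mathcal S=\langle a_1,\dots,a_n\rangle\subseteq\mathbb N$ be a numerical semigroup with minimal generating set $A=\{a_1,\dots,a_n\}$, where $a_1,\dots,a_n$ are $n$ distinct (relatively prime) positive integers. Say that $\mathcal S$ is universally free if it is free for every arrangement of $A$, i.e. if for every ordering $(b_1,\dots,b_n)$ of the elements of $A$ and every $i\in\{1,\dots,n-1\}$, $$\operatorname{lcm}\bigl(b_i,\gcd(b_{i+1},\dots,b_n)\bigr)\in\langle b_{i+1},\dots,b_n\rangle .$$ Let $K$ be any field and let $$I_A=\bigl\langle \mathbf x^{\mathbf u}-\mathbf x^{\mathbf v}\;:\;\mathbf u,\mathbf v\in\mathbb N^n,\ \textstyle\sum_i u_ia_i=\sum_i v_ia_i\bigr\rangle\subseteq K[x_1,\dots,x_n]$$ be the toric ideal of $A$. Then the following are equivalent: 1. $\mathcal S$ is universally free; 2. for every monomial order $\prec$ on $K[x_1,\dots,x_n]$, the reduced Gröbner basis of $I_A$ with respect to $\prec$ has exactly $n-1$ elements; 3. for every monomial order $\prec$ on $K[x_1,\dots,x_n]$, the initial ideal $\operatorname{in}_\prec(I_A)$ is a complete intersection, i.e.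 a proper ideal that can be generated by as many elements as its height. -/

import Mathlib

open MvPolynomial

noncomputable section

/-- A numerical semigroup: a submonoid of `ℕ` generated by a finite set of relatively prime
positive integers. -/
def IsNumericalSemigroup (S : AddSubmonoid ℕ) : Prop :=
  ∃ A : Finset ℕ, (∀ a ∈ A, 0 < a) ∧ A.gcd id = 1 ∧ AddSubmonoid.closure (A : Set ℕ) = S

/-- `A` generates `S` and no proper subset of `A` does. -/
def IsMinimalGeneratingSet (S : AddSubmonoid ℕ) (A : Set ℕ) : Prop :=
  AddSubmonoid.closure A = S ∧ ∀ B : Set ℕ, B ⊂ A → AddSubmonoid.closure B ≠ S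

/-- Freeness for the arrangement `(b 0, …, b (n - 1))`: for every index `i` but the last one,
`lcm (b i, gcd (b (i + 1), …, b (n - 1)))` lies in the submonoid generated by
`b (i + 1), …, b (n - 1)`. -/
def IsFreeForArrangement {n : ℕ} (b : Fin n → ℕ) : Prop :=
  ∀ i : Fin n, (i : ℕ) + 1 < n →
    Nat.lcm (b i) ((Finset.Ioi i).gcd b) ∈ AddSubmonoid.closure (b '' Set.Ioi i)

/-- `S` is universally free: it is free for every arrangement (listing without repetition) of its
minimal generating set. -/
def IsUniversallyFree (S : AddSubmonoid ℕ) : Prop :=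
  ∀ (n : ℕ) (b : Fin n → ℕ), Function.Injective b →
    IsMinimalGeneratingSet S (Set.range b) → IsFreeForArrangement b

/-- The `A`-degree of the monomial with exponent vector `u`. -/
def aDegree {n : ℕ} (a : Fin n → ℕ) (u : Fin n →₀ ℕ) : ℕ :=
  ∑ i, u i * a i

/-- The toric ideal of `a`, spanned by all pure difference `A`-homogeneous binomials. -/
def toricIdeal (K : Type*) [Field K] {n : ℕ} (a : Fin n → ℕ) : Ideal (MvPolynomial (Fin n) K) :=
  Ideal.span {f | ∃ u v : Fin n →₀ ℕ, aDegree a u = aDegree a v ∧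
    f = monomial u (1 : K) - monomial v (1 : K)}

/-- The initial ideal of `I`, spanned by the leading terms of the elements of `I`. -/
def initialIdeal {σ K : Type*} [Field K] (m : MonomialOrder σ) (I : Ideal (MvPolynomial σ K)) :
    Ideal (MvPolynomial σ K) :=
  Ideal.span (m.leadingTerm '' (I : Set (MvPolynomial σ K)))

/-- A Gröbner basis of `I`: a finite subset of `I` whose leading terms span the initial ideal. -/
def IsGroebnerBasis {σ K : Type*} [Field K] (m : MonomialOrder σ) (I : Ideal (MvPolynomial σ K))
    (G : Finset (MvPolynomial σ K)) : Prop :=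
  (∀ g ∈ G, g ∈ I) ∧
    Ideal.span (m.leadingTerm '' (G : Set (MvPolynomial σ K))) = initialIdeal m I

/-- A reduced Gröbner basis: all elements are monic, and no monomial occurring in an element is
divisible by the leading monomial of another element. -/
def IsReducedGroebnerBasis {σ K : Type*} [Field K] (m : MonomialOrder σ)
    (I : Ideal (MvPolynomial σ K)) (G : Finset (MvPolynomial σ K)) : Prop :=
  IsGroebnerBasis m I G ∧ (∀ g ∈ G, m.Monic g) ∧
    ∀ g ∈ G, ∀ h ∈ G, h ≠ g → ∀ d ∈ g.support, ¬ m.degree h ≤ d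

/-- A complete intersection ideal: a proper ideal generated by as many elements as its height. -/
def IsCompleteIntersectionIdeal {R : Type*} [CommRing R] (J : Ideal R) : Prop :=
  J ≠ ⊤ ∧ ∃ s : Finset R, Ideal.span (s : Set R) = J ∧ (s.card : ℕ∞) = J.height

end

/-!
Write `x^u` for a monomial and call `aDegree a u` its degree. For a monomial order `m`, the initial
ideal of the toric ideal is spanned by the `x^u` for which some `x^v ≺ x^u` has the same degree
(`initialIdeal_toricIdeal`), so everything reduces to the combinatorics of its set of minimal
exponents, `minimalInitialExponents m a`. It is finite, and taking leading exponents identifies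
every reduced Gröbner basis with it (`card_of_isReducedGroebnerBasis`).

Comparing powers of the variables of equal degree, all variables but the smallest one have a power
in the initial ideal. Hence its radical is generated by `n - 1` variables, its height is `n - 1`,
and it has at least `n - 1` minimal generators, with equality exactly when all of them are powers
of variables (`minimalInitialExponents_card`). Since no generating set is smaller than the set of
minimal monomial generators (`ncard_minimalInitialExponents_le_card`), the equality also
characterizes complete intersections, order by order (`isCompleteIntersectionIdeal_iff`).

It remains to see that `S` is universally free if and only if, for all orders, all minimal
generators are powers of variables. If `S` is universally free and `x^u - x^v` is a binomial with
`x^u` a minimal generator and `x^v` standard, let `x_i` be the largest of its variables at equal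
degree and `B` the set of the others. Freeness gives a binomial `x_i^c - x^w` with `w` supported in
`B` and `c * a i = lcm (a i) (gcd B)`. Its leading term is `x_i^c`, and `c` is at most the exponent
of `x_i` in `x^u x^v` as `a i` times the latter lies in the group generated by `B`; thus `x_i^c`
divides `x^u` or `x^v`, the latter being impossible as `x^v` is standard (`eq_single_of_free`).
Conversely, use the lexicographic order of an arrangement. With `B` the set of the variables behind
`x_i` and `c` as before, there are standard monomials `x^w`, `x^w'` in the variables of `B` such
that `x_i^c x^w` and `x^w'` have the same degree. So the former lies in the initial ideal, and as
this is generated by powers of variables, it contains some `x_i^d` with `d ≤ c`; by elimination and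
minimality of `c` this comes from a binomial `x_i^c - x^v` with `v` supported in `B`, which is
freeness (`isFreeForArrangement_of_lexPerm`).
-/

section

open scoped MonomialOrder

variable {n : ℕ}

/-! ### Degrees and submonoids of `ℕ` -/

@[simp]
lemma aDegree_zero (a : Fin n → ℕ) : aDegree a 0 = 0 := by
  simp [aDegree]

lemma aDegree_add (a : Fin n → ℕ) (u v : Fin n →₀ ℕ) :
    aDegree a (u + v) = aDegree a u + aDegree a v := by
  simp [aDegree, add_mul, Finset.sum_add_distrib]

@[simp]
lemma aDegree_single (a : Fin n → ℕ) (i : Fin n) (c : ℕ) :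
    aDegree a (Finsupp.single i c) = c * a i := by
  simp [aDegree, Finsupp.single_apply]

lemma eq_zero_of_aDegree_eq_zero {a : Fin n → ℕ} (ha : ∀ i, 0 < a i) {u : Fin n →₀ ℕ}
    (h : aDegree a u = 0) : u = 0 := by
  ext i
  have := (Finset.sum_eq_zero_iff.1 h) i (Finset.mem_univ i)
  simpa [(ha i).ne'] using this

lemma dvd_aDegree {a : Fin n → ℕ} {g : ℕ} {u : Fin n →₀ ℕ} (h : ∀ j, u j ≠ 0 → g ∣ a j) :
    g ∣ aDegree a u := by
  refine Finset.dvd_sum fun j _ => ?_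
  by_cases hj : u j = 0
  · simp [hj]
  · exact (h j hj).mul_left _

/-- The submonoid generated by the `a j` with `j ∈ B` consists of the degrees of the monomials in
the variables indexed by `B`. -/
lemma mem_closure_image_iff {a : Fin n → ℕ} {B : Set (Fin n)} {s : ℕ} :
    s ∈ AddSubmonoid.closure (a '' B) ↔
      ∃ u : Fin n →₀ ℕ, (∀ j, u j ≠ 0 → j ∈ B) ∧ aDegree a u = s := by
  constructor
  · intro hs
    induction hs using AddSubmonoid.closure_induction with
    | mem x hx =>
      obtain ⟨j, hj, rfl⟩ := hx
      refine ⟨Finsupp.single j 1, fun l hl => ?_, by simp⟩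
      obtain rfl : j = l := by
        by_contra hne
        exact hl (Finsupp.single_eq_of_ne (Ne.symm hne))
      exact hj
    | zero => exact ⟨0, by simp, by simp⟩
    | add x y _ _ hx hy =>
      obtain ⟨u, hu, rfl⟩ := hx
      obtain ⟨v, hv, rfl⟩ := hy
      refine ⟨u + v, fun j hj => ?_, aDegree_add a u v⟩
      by_cases h : u j = 0
      · exact hv j (by simpa [h] using hj)
      · exact hu j h
  · rintro ⟨u, hu, rfl⟩
    refine AddSubmonoid.sum_mem _ fun j _ => ?_
    by_cases hj : u j = 0
    · simp [hj]
    · rw [← smul_eq_mul]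
      exact nsmul_mem (AddSubmonoid.subset_closure (Set.mem_image_of_mem a (hu j hj))) _

lemma exists_mul_eq_lcm {a g : ℕ} (ha : 0 < a) (hg : 0 < g) :
    ∃ c, 0 < c ∧ Nat.lcm a g = c * a := by
  obtain ⟨c, hc⟩ := Nat.dvd_lcm_left a g
  refine ⟨c, Nat.pos_of_ne_zero ?_, by rw [hc, mul_comm]⟩
  rintro rfl
  exact (Nat.lcm_pos ha hg).ne' (by simpa using hc)

lemma Finset.gcd_pos_of_nonempty {ι : Type*} {f : ι → ℕ} {s : Finset ι} (hs : s.Nonempty)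
    (hf : ∀ i ∈ s, 0 < f i) : 0 < s.gcd f := by
  obtain ⟨i, hi⟩ := hs
  exact Nat.pos_of_dvd_of_pos (Finset.gcd_dvd hi) (hf i hi)

/-! ### Minimal generating sets -/

lemma IsMinimalGeneratingSet.notMem_closure_diff {S : AddSubmonoid ℕ} {A : Set ℕ}
    (hA : IsMinimalGeneratingSet S A) {x : ℕ} (hx : x ∈ A) :
    x ∉ AddSubmonoid.closure (A \ {x}) := by
  intro h
  refine hA.2 (A \ {x}) ⟨Set.sdiff_subset, fun hs => (hs hx).2 rfl⟩ ?_
  rw [← hA.1]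
  refine le_antisymm (AddSubmonoid.closure_mono Set.sdiff_subset)
    (AddSubmonoid.closure_le.2 fun y hy => ?_)
  by_cases hyx : y = x
  · exact hyx ▸ h
  · exact AddSubmonoid.subset_closure ⟨hy, hyx⟩

lemma IsMinimalGeneratingSet.pos {S : AddSubmonoid ℕ} {A : Set ℕ}
    (hA : IsMinimalGeneratingSet S A) {x : ℕ} (hx : x ∈ A) : 0 < x := by
  refine Nat.pos_of_ne_zero ?_
  rintro rfl
  exact hA.notMem_closure_diff hx (zero_mem _)

/-- A minimal generator lies in every generating set: it cannot be written as a sum of smaller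
elements of the semigroup. -/
lemma IsMinimalGeneratingSet.subset_of_closure_eq {S : AddSubmonoid ℕ} {A B : Set ℕ}
    (hA : IsMinimalGeneratingSet S A) (hB : AddSubmonoid.closure B = S) : A ⊆ B := by
  -- An element of `S` below the generator `x` only involves generators other than `x`.
  have key : ∀ x ∈ A, ∀ y ∈ AddSubmonoid.closure A, y < x →
      y ∈ AddSubmonoid.closure (A \ {x}) := by
    intro x hx y hy
    induction hy using AddSubmonoid.closure_induction with
    | mem z hz => exact fun hlt => AddSubmonoid.subset_closure ⟨hz, hlt.ne⟩
    | zero => exact fun _ => zero_mem _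
    | add z w _ _ hz hw => exact fun hlt => add_mem (hz (by omega)) (hw (by omega))
  intro x hx
  have hx0 := hA.pos hx
  have hxB : x ∈ AddSubmonoid.closure B := by
    rw [hB, ← hA.1]
    exact AddSubmonoid.subset_closure hx
  have : ∀ y ∈ AddSubmonoid.closure B, y = x → x ∈ B := by
    intro y hy
    induction hy using AddSubmonoid.closure_induction with
    | mem z hz => exact fun h => h ▸ hz
    | zero => exact fun h => absurd h hx0.ne
    | add z w hz hw ihz ihw =>
      intro h
      rcases Nat.eq_zero_or_pos z with hz0 | hz0
      · exact ihw (by omega)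
      rcases Nat.eq_zero_or_pos w with hw0 | hw0
      · exact ihz (by omega)
      rw [hB, ← hA.1] at hz hw
      have hzw := add_mem (key x hx z hz (by omega)) (key x hx w hw (by omega))
      rw [h] at hzw
      exact absurd hzw (hA.notMem_closure_diff hx)
  exact this x hxB rfl

lemma IsMinimalGeneratingSet.unique {S : AddSubmonoid ℕ} {A B : Set ℕ}
    (hA : IsMinimalGeneratingSet S A) (hB : IsMinimalGeneratingSet S B) : A = B :=
  (hA.subset_of_closure_eq hB.1).antisymm (hB.subset_of_closure_eq hA.1)

/-- The arrangements of the minimal generating set `{a i}` are the permutations of `a`. -/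
lemma isUniversallyFree_iff {S : AddSubmonoid ℕ} {a : Fin n → ℕ} (ha : Function.Injective a)
    (hA : IsMinimalGeneratingSet S (Set.range a)) :
    IsUniversallyFree S ↔ ∀ σ : Equiv.Perm (Fin n), IsFreeForArrangement (a ∘ σ) := by
  constructor
  · intro h σ
    refine h n _ (ha.comp σ.injective) ?_
    rwa [σ.surjective.range_comp]
  · intro h l b hb hB
    have hr : Set.range b = Set.range a := hB.unique hA
    obtain rfl : l = n := by
      have := congrArg Set.ncard hr
      rwa [← Set.image_univ, ← Set.image_univ, Set.ncard_image_of_injective _ hb,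
        Set.ncard_image_of_injective _ ha, Set.ncard_univ, Set.ncard_univ, Nat.card_fin,
        Nat.card_fin] at this
    have hex : ∀ i, ∃ j, a j = b i := fun i => by
      have : b i ∈ Set.range a := hr ▸ Set.mem_range_self i
      exact this
    choose σ hσ using hex
    have hinj : Function.Injective σ := fun i j hij => hb (by rw [← hσ, ← hσ, hij])
    have := h (Equiv.ofBijective σ (Finite.injective_iff_bijective.1 hinj))
    convert this using 1
    funext i
    exact (hσ i).symm

/-- Freeness for all arrangements involves an index `i` and the set `B` of the indices behind it,
and any nonempty `B` not containing `i` occurs. -/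
lemma forall_perm_isFreeForArrangement_iff (a : Fin n → ℕ) :
    (∀ σ : Equiv.Perm (Fin n), IsFreeForArrangement (a ∘ σ)) ↔
      ∀ (i : Fin n) (B : Finset (Fin n)), B.Nonempty → i ∉ B →
        Nat.lcm (a i) (B.gcd a) ∈ AddSubmonoid.closure (a '' (B : Set (Fin n))) := by
  constructor
  · intro h i B hB hi
    -- Sort the indices so that `B` comes last, with `i` just before it.
    let f : Fin n → ℕ := fun j => if j ∈ B then 2 else if j = i then 1 else 0
    have hmono : Monotone (f ∘ Tuple.sort f) := Tuple.monotone_sort f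
    set σ := Tuple.sort f with hσ
    set p := σ.symm i with hp
    have hσp : σ p = i := by simp [hp]
    have hfp : f (σ p) = 1 := by simp [hσp, f, hi]
    have hIoi : ∀ j, p < j ↔ σ j ∈ B := by
      intro j
      constructor
      · intro hj
        have h1 : f (σ p) ≤ f (σ j) := hmono hj.le
        rw [hfp] at h1
        by_contra hB'
        have hne : σ j ≠ i := fun he => hj.ne' (σ.injective (he.trans hσp.symm))
        simp [f, hB', hne] at h1
      · intro hj
        by_contra hlt
        have h1 : f (σ j) ≤ f (σ p) := hmono (not_lt.1 hlt)
        rw [hfp] at h1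
        simp [f, hj] at h1
    obtain ⟨b, hb⟩ := hB
    have hlt : (p : ℕ) + 1 < n := by
      have : p < σ.symm b := (hIoi _).2 (by simpa using hb)
      have h2 : (p : ℕ) < (σ.symm b : ℕ) := this
      omega
    have := h σ p hlt
    have himg : B = (Finset.Ioi p).image σ := by
      ext j
      simp only [Finset.mem_image, Finset.mem_Ioi]
      constructor
      · intro hj
        exact ⟨σ.symm j, (hIoi _).2 (by simpa using hj), by simp⟩
      · rintro ⟨l, hl, rfl⟩
        exact (hIoi l).1 hl
    have hgcd : B.gcd a = (Finset.Ioi p).gcd (a ∘ σ) := by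
      rw [himg, Finset.gcd_image]
    rw [hgcd]
    rw [Function.comp_apply, hσp, Set.image_comp] at this
    convert this using 3
    rw [himg]
    simp
  · intro h σ i hi
    have := h (σ i) ((Finset.Ioi i).image σ)
      ⟨σ ⟨i + 1, hi⟩, Finset.mem_image_of_mem _ (Finset.mem_Ioi.2 (Fin.lt_def.2 (by simp)))⟩
      (by simp)
    rw [Finset.gcd_image] at this
    rw [Set.image_comp, Function.comp_apply]
    simpa using this

/-! ### Leading exponents of the toric ideal -/

/-- The exponents `u` for which some `v ≺ u` has the same `A`-degree; these are the exponents of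
the monomials in the initial ideal of the toric ideal of `a`. -/
def initialExponents (m : MonomialOrder (Fin n)) (a : Fin n → ℕ) : Set (Fin n →₀ ℕ) :=
  {u | ∃ v, aDegree a v = aDegree a u ∧ v ≺[m] u}

/-- The exponents of the minimal monomial generators of the initial ideal of the toric ideal. -/
def minimalInitialExponents (m : MonomialOrder (Fin n)) (a : Fin n → ℕ) : Set (Fin n →₀ ℕ) :=
  {u | Minimal (· ∈ initialExponents m a) u}

variable {m : MonomialOrder (Fin n)} {a : Fin n → ℕ}

lemma initialExponents_add_right {u : Fin n →₀ ℕ} (hu : u ∈ initialExponents m a)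
    (w : Fin n →₀ ℕ) : u + w ∈ initialExponents m a := by
  obtain ⟨v, hv, hlt⟩ := hu
  refine ⟨v + w, by rw [aDegree_add, aDegree_add, hv], ?_⟩
  rw [map_add, map_add]
  exact add_lt_add_left hlt _

lemma initialExponents_mono {u u' : Fin n →₀ ℕ} (hu : u ∈ initialExponents m a) (h : u ≤ u') :
    u' ∈ initialExponents m a := by
  obtain ⟨w, rfl⟩ := exists_add_of_le h
  exact initialExponents_add_right hu w

lemma zero_notMem_initialExponents : (0 : Fin n →₀ ℕ) ∉ initialExponents m a := by
  rintro ⟨v, -, hv⟩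
  rw [map_zero] at hv
  exact absurd hv (not_lt.2 (m.zero_le _))

lemma exists_minimalInitialExponents_le {u : Fin n →₀ ℕ} (hu : u ∈ initialExponents m a) :
    ∃ p ∈ minimalInitialExponents m a, p ≤ u := by
  obtain ⟨p, hle, hp⟩ := exists_minimal_le_of_wellFoundedLT (· ∈ initialExponents m a) u hu
  exact ⟨p, hp, hle⟩

/-- Dickson's lemma. -/
lemma finite_minimalInitialExponents : (minimalInitialExponents m a).Finite :=
  WellQuasiOrderedLE.finite_of_isAntichain (setOfPred_minimal_antichain _)

/-- Every monomial reduces to a standard monomial of the same degree. -/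
lemma exists_notMem_initialExponents (m : MonomialOrder (Fin n)) (a : Fin n → ℕ)
    (u : Fin n →₀ ℕ) :
    ∃ v, aDegree a v = aDegree a u ∧ v ≼[m] u ∧ v ∉ initialExponents m a := by
  obtain ⟨s, ⟨v, ⟨hdeg, hle⟩, rfl⟩, hmin⟩ := WellFounded.has_min
    (wellFounded_lt (α := m.syn)) (m.toSyn '' {v | aDegree a v = aDegree a u ∧ v ≼[m] u})
    ⟨_, u, ⟨rfl, le_rfl⟩, rfl⟩
  refine ⟨v, hdeg, hle, ?_⟩
  rintro ⟨w, hw, hlt⟩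
  exact hmin _ ⟨w, ⟨hw.trans hdeg, hlt.le.trans hle⟩, rfl⟩ hlt

/-- Of two distinct monomials of the same degree one is in the initial ideal. -/
lemma mem_initialExponents_or {u v : Fin n →₀ ℕ} (hdeg : aDegree a u = aDegree a v)
    (hne : u ≠ v) : u ∈ initialExponents m a ∨ v ∈ initialExponents m a := by
  rcases lt_or_gt_of_ne (m.toSyn.injective.ne hne) with h | h
  · exact Or.inr ⟨u, hdeg, h⟩
  · exact Or.inl ⟨v, hdeg.symm, h⟩

/-! ### Comparing variables at equal degree -/

/-- The exponent of the power of `x_j` of degree `∏ l, a l`. -/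
noncomputable def normalizedPower (a : Fin n → ℕ) (j : Fin n) : Fin n →₀ ℕ :=
  Finsupp.single j (∏ l ∈ Finset.univ.erase j, a l)

lemma smul_single_eq_smul_normalizedPower (a : Fin n → ℕ) (j : Fin n) (d : ℕ) :
    (∏ l, a l) • Finsupp.single j d = (d * a j) • normalizedPower a j := by
  rw [normalizedPower, Finsupp.smul_single, Finsupp.smul_single, smul_eq_mul, smul_eq_mul,
    ← Finset.mul_prod_erase _ _ (Finset.mem_univ j)]
  congr 1
  ring

lemma smul_eq_sum_smul_normalizedPower (a : Fin n → ℕ) (w : Fin n →₀ ℕ) :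
    (∏ l, a l) • w = ∑ j, (w j * a j) • normalizedPower a j := by
  conv_lhs => rw [← Finsupp.univ_sum_single w, Finset.smul_sum]
  exact Finset.sum_congr rfl fun j _ => smul_single_eq_smul_normalizedPower a j _

lemma sum_smul_normalizedPower_eq {w : Fin n →₀ ℕ} {i : Fin n} {d : ℕ}
    (hdeg : aDegree a w = d * a i) :
    ∑ j, (w j * a j) • m.toSyn (normalizedPower a i) =
      (∏ l, a l) • m.toSyn (Finsupp.single i d) := by
  rw [← Finset.sum_smul, show ∑ j, w j * a j = d * a i from hdeg, ← map_nsmul, ← map_nsmul,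
    smul_single_eq_smul_normalizedPower]

lemma le_of_prod_smul_le (ha : ∀ i, 0 < a i) {x y : m.syn}
    (h : (∏ l, a l) • x ≤ (∏ l, a l) • y) : x ≤ y :=
  (nsmul_le_nsmul_iff_right (Finset.prod_pos fun i _ => ha i).ne').1 h

/-- If, among powers of the same degree, those of `x_i` are at least as large as those of the
variables in `E`, then a power of `x_i` is at least as large as any monomial of its degree in the
variables of `E`. -/
lemma toSyn_le_single (ha : ∀ i, 0 < a i) {E : Set (Fin n)} {i : Fin n}
    (hi : ∀ j ∈ E, normalizedPower a j ≼[m] normalizedPower a i) {w : Fin n →₀ ℕ}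
    (hw : ∀ j, w j ≠ 0 → j ∈ E) {d : ℕ} (hdeg : aDegree a w = d * a i) :
    w ≼[m] Finsupp.single i d := by
  refine le_of_prod_smul_le ha ?_
  rw [← sum_smul_normalizedPower_eq hdeg, ← map_nsmul, smul_eq_sum_smul_normalizedPower, map_sum]
  refine Finset.sum_le_sum fun j _ => ?_
  rw [map_nsmul]
  by_cases hj : w j = 0
  · simp [hj]
  · exact nsmul_le_nsmul_right (hi j (hw j hj)) _

lemma single_toSyn_le (ha : ∀ i, 0 < a i) {i : Fin n}
    (hi : ∀ j, normalizedPower a i ≼[m] normalizedPower a j) {w : Fin n →₀ ℕ}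
    {d : ℕ} (hdeg : aDegree a w = d * a i) :
    Finsupp.single i d ≼[m] w := by
  refine le_of_prod_smul_le ha ?_
  rw [← sum_smul_normalizedPower_eq hdeg, ← map_nsmul, smul_eq_sum_smul_normalizedPower, map_sum]
  refine Finset.sum_le_sum fun j _ => ?_
  rw [map_nsmul]
  exact nsmul_le_nsmul_right (hi j) _

/-- There is exactly one variable without a power in the initial ideal. -/
lemma exists_variable_without_power (ha : ∀ i, 0 < a i) (hn : 0 < n)
    (m : MonomialOrder (Fin n)) :
    ∃ k : Fin n, (∀ d, Finsupp.single k d ∉ initialExponents m a) ∧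
      ∀ i, i ≠ k → ∃ d, Finsupp.single i d ∈ initialExponents m a := by
  have : Nonempty (Fin n) := ⟨⟨0, hn⟩⟩
  obtain ⟨k, hk⟩ := Finite.exists_min fun j => m.toSyn (normalizedPower a j)
  refine ⟨k, ?_, ?_⟩
  · rintro d ⟨v, hv, hlt⟩
    exact absurd (single_toSyn_le ha hk (by simpa using hv)) (not_le.2 hlt)
  · intro i hik
    refine ⟨a k, Finsupp.single k (a i), by simp [mul_comm], ?_⟩
    refine lt_of_le_of_ne (single_toSyn_le ha hk (by simp [mul_comm])) ?_
    refine m.toSyn.injective.ne fun h => ?_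
    have := DFunLike.congr_fun h k
    simp [hik, (ha i).ne'] at this

/-- A power of `x_i` in the initial ideal of least possible exponent is a minimal generator. -/
lemma exists_single_mem_minimalInitialExponents {i : Fin n}
    (h : ∃ d, Finsupp.single i d ∈ initialExponents m a) :
    ∃ d, d ≠ 0 ∧ Finsupp.single i d ∈ minimalInitialExponents m a := by
  obtain ⟨d, hd⟩ := h
  obtain ⟨p, hp, hle⟩ := exists_minimalInitialExponents_le hd
  have hps : p = Finsupp.single i (p i) := by
    ext j
    by_cases hj : j = i
    · subst hj; simp
    · have := hle j
      rw [Finsupp.single_eq_of_ne hj] at this ⊢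
      omega
  refine ⟨p i, fun h0 => ?_, hps ▸ hp⟩
  rw [h0, Finsupp.single_zero] at hps
  exact zero_notMem_initialExponents (hps ▸ hp.prop)

/-- The initial ideal needs at least `n - 1` generators, and `n - 1` suffice precisely when it is
generated by powers of variables. -/
lemma minimalInitialExponents_card (ha : ∀ i, 0 < a i) (hn : 0 < n) (m : MonomialOrder (Fin n)) :
    n - 1 ≤ (minimalInitialExponents m a).ncard ∧
      ((minimalInitialExponents m a).ncard = n - 1 ↔
        ∀ u ∈ minimalInitialExponents m a, ∃ i d, u = Finsupp.single i d) := by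
  obtain ⟨k, hk, hpow⟩ := exists_variable_without_power ha hn m
  have hex : ∀ i : {i // i ≠ k},
      ∃ d, d ≠ 0 ∧ Finsupp.single i.1 d ∈ minimalInitialExponents m a :=
    fun i => exists_single_mem_minimalInitialExponents (hpow i.1 i.2)
  choose c hc0 hc using hex
  let p : {i // i ≠ k} → (Fin n →₀ ℕ) := fun i => Finsupp.single i.1 (c i)
  have hinj : Function.Injective p := fun i j hij => by
    rcases (Finsupp.single_eq_single_iff _ _ _ _).1 hij with h | h
    · exact Subtype.ext h.1
    · exact absurd h.1 (hc0 i)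
  have hsub : Set.range p ⊆ minimalInitialExponents m a := by
    rintro _ ⟨i, rfl⟩
    exact hc i
  have hcard : (Set.range p).ncard = n - 1 := by
    rw [← Set.image_univ, Set.ncard_image_of_injective _ hinj, Set.ncard_univ,
      Nat.card_eq_fintype_card, Fintype.card_subtype_compl, Fintype.card_fin,
      Fintype.card_subtype_eq]
  have hfin := finite_minimalInitialExponents (m := m) (a := a)
  refine ⟨hcard ▸ Set.ncard_le_ncard hsub hfin, fun h u hu => ?_, fun h => ?_⟩
  · have : Set.range p = minimalInitialExponents m a :=
      Set.eq_of_subset_of_ncard_le hsub (by rw [h, hcard]) hfin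
    rw [← this] at hu
    obtain ⟨i, rfl⟩ := hu
    exact ⟨_, _, rfl⟩
  · rw [← hcard]
    congr 1
    refine Set.Subset.antisymm (fun u hu => ?_) hsub
    obtain ⟨i, d, rfl⟩ := h u hu
    have hik : i ≠ k := by
      rintro rfl
      exact hk d hu.prop
    refine ⟨⟨i, hik⟩, ?_⟩
    -- Powers of the same variable are comparable, so at most one of them is minimal.
    rcases le_total d (c ⟨i, hik⟩) with h' | h'
    · exact (hc ⟨i, hik⟩).eq_of_ge hu.prop (Finsupp.single_le_single.2 h')
    · exact (hu.eq_of_ge (hc ⟨i, hik⟩).prop (Finsupp.single_le_single.2 h')).symm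

/-! ### Freeness and initial ideals generated by powers of variables -/

/-- Distinct monomials of a minimal binomial have disjoint supports: a common variable could be
cancelled. -/
lemma eq_zero_or_eq_zero_of_minimal {u v : Fin n →₀ ℕ} (hu : u ∈ minimalInitialExponents m a)
    (hdeg : aDegree a v = aDegree a u) (hlt : v ≺[m] u) (j : Fin n) : u j = 0 ∨ v j = 0 := by
  by_contra! h
  have hej : ∀ w : Fin n →₀ ℕ, w j ≠ 0 → w - Finsupp.single j 1 + Finsupp.single j 1 = w :=
    fun w hw => tsub_add_cancel_of_le (Finsupp.single_le_iff.2 (Nat.one_le_iff_ne_zero.2 hw))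
  have hmem : u - Finsupp.single j 1 ∈ initialExponents m a := by
    refine ⟨v - Finsupp.single j 1, ?_, ?_⟩
    · have h1 := aDegree_add a (v - Finsupp.single j 1) (Finsupp.single j 1)
      have h2 := aDegree_add a (u - Finsupp.single j 1) (Finsupp.single j 1)
      rw [hej _ h.1] at h2
      rw [hej _ h.2] at h1
      omega
    · rw [← hej _ h.1, ← hej _ h.2, map_add, map_add] at hlt
      exact lt_of_add_lt_add_right hlt
  have := hu.le_of_le hmem tsub_le_self j
  rw [Finsupp.tsub_apply, Finsupp.single_eq_same] at this
  omega

/-- Let `x^u` and `x^v` have the same degree, and let `x_i` divide `x^u`. If `B` contains the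
indices of all other variables of `x^u` and those of all variables of `x^v`, then the exponent `c`
with `c * a i = lcm (a i) (gcd B)` is at most `u i`: the gcd of `B` divides `u i * a i`. -/
lemma le_of_lcm_eq {u v : Fin n →₀ ℕ} {i : Fin n} {B : Finset (Fin n)} {c : ℕ}
    (ha : ∀ i, 0 < a i)
    (hdeg : aDegree a v = aDegree a u) (hu : ∀ j, j ≠ i → u j ≠ 0 → j ∈ B)
    (hv : ∀ j, v j ≠ 0 → j ∈ B) (hui : u i ≠ 0) (hc : Nat.lcm (a i) (B.gcd a) = c * a i) :
    c ≤ u i := by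
  have hdvd_v : B.gcd a ∣ aDegree a v := dvd_aDegree fun j hj => Finset.gcd_dvd (hv j hj)
  have hdvd_u : B.gcd a ∣ aDegree a (u.erase i) := by
    refine dvd_aDegree fun j hj => ?_
    have hji : j ≠ i := by
      rintro rfl
      simp at hj
    rw [Finsupp.erase_ne hji] at hj
    exact Finset.gcd_dvd (hu j hji hj)
  have hsum : aDegree a u = u i * a i + aDegree a (u.erase i) := by
    conv_lhs => rw [← Finsupp.single_add_erase i u, aDegree_add, aDegree_single]
  rw [hdeg, hsum] at hdvd_v
  have hdvd : Nat.lcm (a i) (B.gcd a) ∣ u i * a i :=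
    Nat.lcm_dvd (dvd_mul_left _ _) ((Nat.dvd_add_left hdvd_u).1 hdvd_v)
  rw [hc] at hdvd
  exact Nat.le_of_mul_le_mul_right
    (Nat.le_of_dvd (Nat.mul_pos (Nat.pos_of_ne_zero hui) (ha i)) hdvd) (ha i)

/-- Freeness makes every minimal generator of the initial ideal a power of a variable. Among the
variables of a binomial `x^u - x^v`, take the one, `x_i`, whose powers are the largest at equal
degree; freeness provides a binomial `x_i^c - x^w` in the remaining variables, and `x_i^c` is its
leading term and divides `x^u` or `x^v`. -/
lemma eq_single_of_free (ha : ∀ i, 0 < a i)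
    (hfree : ∀ (i : Fin n) (B : Finset (Fin n)), B.Nonempty → i ∉ B →
      Nat.lcm (a i) (B.gcd a) ∈ AddSubmonoid.closure (a '' (B : Set (Fin n))))
    {u : Fin n →₀ ℕ} (hu : u ∈ minimalInitialExponents m a) :
    ∃ i d, u = Finsupp.single i d := by
  obtain ⟨v₀, hv₀, hlt₀⟩ := hu.prop
  obtain ⟨v, hv, hle, hstd⟩ := exists_notMem_initialExponents m a v₀
  have hdeg : aDegree a v = aDegree a u := hv.trans hv₀
  have hlt : v ≺[m] u := hle.trans_lt hlt₀
  have hdisj := eq_zero_or_eq_zero_of_minimal hu hdeg hlt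
  have hu0 : u ≠ 0 := by
    rintro rfl
    exact zero_notMem_initialExponents hu.prop
  have hv0 : v ≠ 0 := by
    rintro rfl
    exact hu0 (eq_zero_of_aDegree_eq_zero ha (by rw [← hdeg, aDegree_zero]))
  obtain ⟨p, hp⟩ := Finsupp.ne_iff.1 hu0
  obtain ⟨q, hq⟩ := Finsupp.ne_iff.1 hv0
  rw [Finsupp.zero_apply] at hp hq
  obtain ⟨i, hiE, hmax⟩ := Finset.exists_max_image (u.support ∪ v.support)
    (fun j => m.toSyn (normalizedPower a j)) ⟨p, by simp [hp]⟩
  set B := (u.support ∪ v.support).erase i with hB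
  have hBne : B.Nonempty := by
    by_cases hip : i = p
    · refine ⟨q, ?_⟩
      have : q ≠ i := by
        rintro rfl
        exact (hdisj q).elim (fun h => hp (hip ▸ h)) hq
      simp [hB, this, hq]
    · exact ⟨p, by simp [hB, Ne.symm hip, hp]⟩
  have hiB : i ∉ B := Finset.notMem_erase _ _
  obtain ⟨c, hc0, hc⟩ := exists_mul_eq_lcm (ha i)
    (Finset.gcd_pos_of_nonempty hBne fun j _ => ha j)
  have hmem := hfree i B hBne hiB
  rw [hc, mem_closure_image_iff] at hmem
  obtain ⟨w, hwB, hw⟩ := hmem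
  have hpow : Finsupp.single i c ∈ initialExponents m a := by
    refine ⟨w, by simpa using hw, lt_of_le_of_ne ?_ (m.toSyn.injective.ne ?_)⟩
    · exact toSyn_le_single ha (E := (B : Set (Fin n)))
        (fun j hj => hmax j (Finset.mem_of_mem_erase hj)) hwB hw
    · rintro rfl
      exact hiB (hwB i (by simpa using hc0.ne'))
  have hmemB : ∀ j, j ≠ i → (u j ≠ 0 ∨ v j ≠ 0) → j ∈ B := fun j hj h => by
    simpa [hB, hj] using h
  rcases hdisj i with hi | hi
  · -- In this case `x_i^c` would divide the standard monomial `x^v`.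
    have hvi : v i ≠ 0 := by simpa [hi] using hiE
    refine absurd (initialExponents_mono hpow (Finsupp.single_le_iff.2 ?_)) hstd
    refine le_of_lcm_eq ha hdeg.symm (fun j hj h => hmemB j hj (Or.inr h)) (fun j h => ?_) hvi hc
    exact hmemB j (by rintro rfl; exact h hi) (Or.inl h)
  · have hui : u i ≠ 0 := by simpa [hi] using hiE
    refine ⟨i, c, (hu.eq_of_le hpow (Finsupp.single_le_iff.2 ?_)).symm⟩
    refine le_of_lcm_eq ha hdeg (fun j hj h => hmemB j hj (Or.inl h)) (fun j h => ?_) hui hc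
    exact hmemB j (by rintro rfl; exact h hi) (Or.inr h)

/-- The lexicographic order with `x_{σ 0} > x_{σ 1} > ⋯`. -/
noncomputable def MonomialOrder.lexPerm (σ : Equiv.Perm (Fin n)) : MonomialOrder (Fin n) where
  syn := Lex (Fin n →₀ ℕ)
  toSyn := (Finsupp.domCongr σ.symm).trans MonomialOrder.lex.toSyn
  toSyn_monotone := fun u v h => by
    have h' : Finsupp.domCongr σ.symm u ≤ Finsupp.domCongr σ.symm v := fun j => by
      simpa using h (σ j)
    exact MonomialOrder.lex.toSyn_monotone h'

/-- The order `lexPerm σ` eliminates: a monomial smaller than one in the variables from position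
`t` on involves only these variables, too. -/
lemma lexPerm_elimination {σ : Equiv.Perm (Fin n)} {u v : Fin n →₀ ℕ} {P : Fin n → Prop}
    (hP : ∀ j l, j ≤ l → P j → P l)
    (hu : ∀ j, u (σ j) ≠ 0 → P j) (h : v ≼[MonomialOrder.lexPerm σ] u) :
    ∀ j, v (σ j) ≠ 0 → P j := by
  intro l hl
  by_contra hlP
  rcases h.eq_or_lt with h | h
  · rw [(MonomialOrder.lexPerm σ).toSyn.injective h] at hl
    exact hlP (hu l hl)
  · obtain ⟨j, hj, hlt⟩ := Finsupp.Lex.lt_iff.1 h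
    change ∀ l, l < j → v (σ l) = u (σ l) at hj
    change v (σ j) < u (σ j) at hlt
    have hPj : P j := hu j (by omega)
    have hlj : l < j := by
      by_contra hlj
      exact hlP (hP j l (not_lt.1 hlj) hPj)
    exact hlP (hu l (hj l hlj ▸ hl))

/-- A degree in the submonoid of the entries behind position `i` is attained by a standard monomial
for `lexPerm σ` in the corresponding variables. -/
lemma exists_standard_of_mem_closure {σ : Equiv.Perm (Fin n)} {i : Fin n} {s : ℕ}
    (hs : s ∈ AddSubmonoid.closure ((a ∘ σ) '' Set.Ioi i)) :
    ∃ w, (∀ j, w (σ j) ≠ 0 → i < j) ∧ aDegree a w = s ∧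
      w ∉ initialExponents (MonomialOrder.lexPerm σ) a := by
  rw [Set.image_comp, mem_closure_image_iff] at hs
  obtain ⟨u, hu, rfl⟩ := hs
  obtain ⟨w, hw, hle, hstd⟩ := exists_notMem_initialExponents (MonomialOrder.lexPerm σ) a u
  refine ⟨w, lexPerm_elimination (fun j l hjl h => lt_of_lt_of_le h hjl) (fun j hj => ?_) hle, hw,
    hstd⟩
  simpa using hu _ hj

/-- Freeness for the arrangement `σ` holds if the initial ideal for the corresponding lexicographic
order is generated by powers of variables. -/
lemma isFreeForArrangement_of_lexPerm (ha : ∀ i, 0 < a i) (σ : Equiv.Perm (Fin n))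
    (h : ∀ u ∈ minimalInitialExponents (MonomialOrder.lexPerm σ) a, ∃ i d,
      u = Finsupp.single i d) :
    IsFreeForArrangement (a ∘ σ) := by
  intro i hi
  set g := (Finset.Ioi i).gcd (a ∘ σ) with hg
  have hgpos : 0 < g := Finset.gcd_pos_of_nonempty
    ⟨⟨i + 1, hi⟩, Finset.mem_Ioi.2 (Fin.lt_def.2 (by simp))⟩ fun j _ => ha (σ j)
  obtain ⟨c, hc0, hc⟩ := exists_mul_eq_lcm (ha (σ i)) hgpos
  -- All large multiples of the gcd are degrees of monomials in the variables behind `σ i`.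
  have hset : Nat.setGcd ((a ∘ σ) '' Set.Ioi i) ∣ g :=
    Finset.dvd_gcd fun j hj => Nat.setGcd_dvd_of_mem ⟨j, by simpa using hj, rfl⟩
  obtain ⟨N, hN⟩ := Nat.exists_mem_closure_of_ge ((a ∘ σ) '' Set.Ioi i)
  obtain ⟨w, hw, hwdeg, hwstd⟩ := exists_standard_of_mem_closure (σ := σ)
    (hN (N * g) (Nat.le_mul_of_pos_right _ hgpos) (hset.mul_left _))
  obtain ⟨w', hw', hwdeg', hwstd'⟩ := exists_standard_of_mem_closure (σ := σ)
    (hN (N * g + Nat.lcm (a (σ i)) g)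
      ((Nat.le_mul_of_pos_right _ hgpos).trans (Nat.le_add_right _ _))
      (dvd_add (hset.mul_left _) (hset.trans (Nat.dvd_lcm_right _ _))))
  -- The monomials `x_{σ i}^c x^w` and `x^w'` have the same degree and the second one is standard.
  have hmem : w + Finsupp.single (σ i) c ∈
      initialExponents (MonomialOrder.lexPerm σ) a := by
    refine (mem_initialExponents_or (v := w') ?_ ?_).resolve_right hwstd'
    · rw [aDegree_add, aDegree_single, hwdeg, hwdeg', hc]
    · intro he
      have h1 := DFunLike.congr_fun he (σ i)
      have h2 : w' (σ i) = 0 := by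
        by_contra h2
        exact lt_irrefl _ (hw' i h2)
      rw [Finsupp.add_apply, Finsupp.single_eq_same, h2] at h1
      omega
  obtain ⟨p, hp, hple⟩ := exists_minimalInitialExponents_le hmem
  obtain ⟨j, d, rfl⟩ := h p hp
  rw [Finsupp.single_le_iff] at hple
  have hj : j = σ i := by
    by_contra hj
    rw [Finsupp.add_apply, Finsupp.single_eq_of_ne hj, add_zero] at hple
    exact hwstd (initialExponents_mono hp.prop (Finsupp.single_le_iff.2 hple))
  subst hj
  have hwi : w (σ i) = 0 := by
    by_contra h2
    exact lt_irrefl _ (hw i h2)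
  have hdc : d ≤ c := by simpa [hwi] using hple
  -- A binomial `x_{σ i}^d - x^v` only involves variables from `σ i` on.
  obtain ⟨v, hvdeg, hvlt⟩ := hp.prop
  have hv : ∀ j, v (σ j) ≠ 0 → i ≤ j := by
    refine lexPerm_elimination (fun j l hjl h => le_trans h hjl) (fun j hj => ?_) hvlt.le
    by_contra hij
    refine hj (Finsupp.single_eq_of_ne fun he => hij ?_)
    exact (σ.injective he).ge
  have hverase : ∀ j, (v.erase (σ i)) j ≠ 0 → j ∈ σ '' Set.Ioi i := by
    intro j hj
    have hji : j ≠ σ i := by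
      rintro rfl
      simp at hj
    rw [Finsupp.erase_ne hji] at hj
    refine ⟨σ.symm j, lt_of_le_of_ne (hv _ (by simpa using hj)) ?_, by simp⟩
    rintro rfl
    simp at hji
  have hsum : v (σ i) * a (σ i) + aDegree a (v.erase (σ i)) = d * a (σ i) := by
    rw [← aDegree_single a (σ i) d, ← hvdeg]
    conv_rhs => rw [← Finsupp.single_add_erase (σ i) v, aDegree_add, aDegree_single]
  have hlt : v (σ i) < d := by
    by_contra hge
    have hle : d * a (σ i) ≤ v (σ i) * a (σ i) := Nat.mul_le_mul_right _ (not_lt.1 hge)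
    have he : v.erase (σ i) = 0 := eq_zero_of_aDegree_eq_zero ha (by omega)
    have hvd : v (σ i) = d := by
      rw [he, aDegree_zero, add_zero] at hsum
      exact Nat.eq_of_mul_eq_mul_right (ha _) hsum
    have : v = Finsupp.single (σ i) d := by
      rw [← Finsupp.single_add_erase (σ i) v, he, add_zero, hvd]
    exact hvlt.ne (congrArg _ this)
  have hrest : aDegree a (v.erase (σ i)) = (d - v (σ i)) * a (σ i) := by
    rw [Nat.sub_mul]
    omega
  have hdvd : Nat.lcm (a (σ i)) g ∣ (d - v (σ i)) * a (σ i) := by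
    refine Nat.lcm_dvd (dvd_mul_left _ _) ?_
    rw [← hrest]
    refine dvd_aDegree fun j hj => ?_
    obtain ⟨l, hl, rfl⟩ := hverase j hj
    exact Finset.gcd_dvd (f := a ∘ σ) (Finset.mem_Ioi.2 hl)
  rw [hc] at hdvd
  have hcd : c ≤ d - v (σ i) := Nat.le_of_mul_le_mul_right
    (Nat.le_of_dvd (Nat.mul_pos (by omega) (ha _)) hdvd) (ha _)
  have hcd' : d - v (σ i) = c := by omega
  rw [Function.comp_apply, hc, Set.image_comp, mem_closure_image_iff]
  exact ⟨v.erase (σ i), hverase, by rw [hrest, hcd']⟩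

/-! ### The initial ideal of the toric ideal -/

variable {K : Type*} [Field K]

lemma prod_X_pow_pow_eq (a : Fin n → ℕ) (u : Fin n →₀ ℕ) :
    ∏ i, ((Polynomial.X : Polynomial K) ^ a i) ^ u i = Polynomial.X ^ aDegree a u := by
  rw [aDegree, ← Finset.prod_pow_eq_pow_sum]
  exact Finset.prod_congr rfl fun i _ => by rw [← pow_mul, mul_comm]

/-- The toric ideal lies in the kernel of `x_i ↦ t ^ a i`. -/
lemma aeval_eq_zero_of_mem_toricIdeal {f : MvPolynomial (Fin n) K} (hf : f ∈ toricIdeal K a) :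
    aeval (fun i => (Polynomial.X : Polynomial K) ^ a i) f = 0 := by
  have hle : toricIdeal K a ≤
      RingHom.ker (aeval fun i => (Polynomial.X : Polynomial K) ^ a i : _ →ₐ[K] _) := by
    refine Ideal.span_le.2 ?_
    rintro _ ⟨u, v, huv, rfl⟩
    simp [RingHom.mem_ker, aeval_monomial, Finsupp.prod_fintype, prod_X_pow_pow_eq, huv]
  exact hle hf

/-- No monomial of an element of the toric ideal is alone in its degree. -/
lemma exists_ne_mem_support_of_mem_toricIdeal {f : MvPolynomial (Fin n) K}
    (hf : f ∈ toricIdeal K a) {u : Fin n →₀ ℕ} (hu : u ∈ f.support) :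
    ∃ v ∈ f.support, v ≠ u ∧ aDegree a v = aDegree a u := by
  by_contra! h
  have h0 := congrArg (fun p => Polynomial.coeff p (aDegree a u))
    (aeval_eq_zero_of_mem_toricIdeal hf)
  simp only [aeval_def, eval₂_eq', prod_X_pow_pow_eq, Polynomial.algebraMap_eq,
    Polynomial.finsetSum_coeff, Polynomial.coeff_C_mul, Polynomial.coeff_X_pow,
    Polynomial.coeff_zero] at h0
  rw [Finset.sum_eq_single u, if_pos rfl, mul_one] at h0
  · exact (mem_support_iff.1 hu) h0
  · intro v hv hvu
    rw [if_neg (h v hv hvu).symm, mul_zero]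
  · exact fun h => absurd hu h

lemma degree_mem_initialExponents {f : MvPolynomial (Fin n) K} (hf : f ∈ toricIdeal K a)
    (hf0 : f ≠ 0) : m.degree f ∈ initialExponents m a := by
  obtain ⟨v, hv, hne, hdeg⟩ := exists_ne_mem_support_of_mem_toricIdeal hf
    (m.degree_mem_support hf0)
  exact ⟨v, hdeg, lt_of_le_of_ne (m.le_degree hv) (m.toSyn.injective.ne hne)⟩

lemma degree_monomial_sub_monomial {u v : Fin n →₀ ℕ} (h : v ≺[m] u) :
    m.degree (monomial u (1 : K) - monomial v 1) = u := by
  classical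
  have hd : ∀ w : Fin n →₀ ℕ, m.degree (monomial w (1 : K)) = w := fun w => by
    rw [MonomialOrder.degree_monomial, if_neg one_ne_zero]
  rw [MonomialOrder.degree_sub_of_lt (by rwa [hd, hd]), hd]

lemma monic_monomial_sub_monomial {u v : Fin n →₀ ℕ} (h : v ≺[m] u) :
    m.Monic (monomial u (1 : K) - monomial v 1) := by
  have hne : v ≠ u := by
    rintro rfl
    exact lt_irrefl _ h
  rw [MonomialOrder.Monic, MonomialOrder.leadingCoeff, degree_monomial_sub_monomial h]
  simp [hne]

lemma monomial_sub_monomial_mem_toricIdeal {u v : Fin n →₀ ℕ} (h : aDegree a u = aDegree a v) :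
    monomial u (1 : K) - monomial v 1 ∈ toricIdeal K a :=
  Ideal.subset_span ⟨u, v, h, rfl⟩

variable (K m a) in
lemma initialIdeal_toricIdeal :
    initialIdeal m (toricIdeal K a) =
      Ideal.span ((fun u => monomial u (1 : K)) '' initialExponents m a) := by
  refine le_antisymm (Ideal.span_le.2 ?_) (Ideal.span_le.2 ?_)
  · rintro _ ⟨f, hf, rfl⟩
    by_cases hf0 : f = 0
    · simp [hf0]
    · rw [SetLike.mem_coe, ← m.C_mul_leadingCoeff_monomial_degree]
      exact Ideal.mul_mem_left _ _
        (Ideal.subset_span ⟨_, degree_mem_initialExponents hf hf0, rfl⟩)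
  · rintro _ ⟨u, ⟨v, hdeg, hlt⟩, rfl⟩
    refine Ideal.subset_span ⟨_, monomial_sub_monomial_mem_toricIdeal hdeg.symm, ?_⟩
    rw [MonomialOrder.leadingTerm, degree_monomial_sub_monomial hlt,
      (monic_monomial_sub_monomial hlt).leadingCoeff_eq_one]

lemma monomial_mem_span_monomial_iff {s : Set (Fin n →₀ ℕ)} {u : Fin n →₀ ℕ} :
    monomial u (1 : K) ∈ Ideal.span ((fun u => monomial u (1 : K)) '' s) ↔ ∃ p ∈ s, p ≤ u := by
  classical
  rw [mem_ideal_span_monomial_image, support_monomial, if_neg one_ne_zero]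
  simp

lemma monomial_mem_initialIdeal_iff {u : Fin n →₀ ℕ} :
    monomial u (1 : K) ∈ initialIdeal m (toricIdeal K a) ↔ u ∈ initialExponents m a := by
  rw [initialIdeal_toricIdeal, monomial_mem_span_monomial_iff]
  exact ⟨fun ⟨p, hp, hle⟩ => initialExponents_mono hp hle, fun h => ⟨u, h, le_rfl⟩⟩

lemma support_subset_initialExponents {f : MvPolynomial (Fin n) K}
    (hf : f ∈ initialIdeal m (toricIdeal K a)) {u : Fin n →₀ ℕ} (hu : u ∈ f.support) :
    u ∈ initialExponents m a := by
  rw [initialIdeal_toricIdeal, mem_ideal_span_monomial_image] at hf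
  obtain ⟨p, hp, hle⟩ := hf u hu
  exact initialExponents_mono hp hle

variable (K m a) in
lemma initialIdeal_eq_span_minimal :
    initialIdeal m (toricIdeal K a) =
      Ideal.span ((fun u => monomial u (1 : K)) '' minimalInitialExponents m a) := by
  refine le_antisymm ?_ ?_
  · rw [initialIdeal_toricIdeal, Ideal.span_le]
    rintro _ ⟨u, hu, rfl⟩
    obtain ⟨p, hp, hle⟩ := exists_minimalInitialExponents_le hu
    exact monomial_mem_span_monomial_iff.2 ⟨p, hp, hle⟩
  · rw [initialIdeal_toricIdeal]
    exact Ideal.span_mono (Set.image_mono fun u hu => hu.prop)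

/-! ### Reduced Gröbner bases of the toric ideal -/

/-- Taking leading exponents is a bijection from a reduced Gröbner basis to the minimal generators
of the initial ideal. -/
lemma card_of_isReducedGroebnerBasis {G : Finset (MvPolynomial (Fin n) K)}
    (hG : IsReducedGroebnerBasis m (toricIdeal K a) G) :
    G.card = (minimalInitialExponents m a).ncard := by
  obtain ⟨⟨-, hspan⟩, hmonic, hred⟩ := hG
  have hanti : ∀ g ∈ G, ∀ h ∈ G, m.degree h ≤ m.degree g → h = g := by
    intro g hg h hh hle
    by_contra hne
    exact hred g hg h hh hne _ (m.degree_mem_support (hmonic g hg).ne_zero) hle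
  have hmem : ∀ u, u ∈ initialExponents m a ↔ ∃ g ∈ G, m.degree g ≤ u := by
    intro u
    have himg : m.leadingTerm '' (G : Set (MvPolynomial (Fin n) K)) =
        (fun u => monomial u (1 : K)) '' (m.degree '' (G : Set (MvPolynomial (Fin n) K))) := by
      rw [Set.image_image]
      refine Set.image_congr fun g hg => ?_
      rw [MonomialOrder.leadingTerm, (hmonic g hg).leadingCoeff_eq_one]
    rw [← monomial_mem_initialIdeal_iff (K := K), ← hspan, himg, monomial_mem_span_monomial_iff]
    simp
  have himage : minimalInitialExponents m a = m.degree '' (G : Set (MvPolynomial (Fin n) K)) := by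
    ext u
    constructor
    · intro hu
      obtain ⟨g, hg, hle⟩ := (hmem u).1 hu.prop
      exact ⟨g, hg, hu.eq_of_le ((hmem _).2 ⟨g, hg, le_rfl⟩) hle⟩
    · rintro ⟨g, hg, rfl⟩
      refine ⟨(hmem _).2 ⟨g, hg, le_rfl⟩, fun v hv hle => ?_⟩
      obtain ⟨h, hh, hle'⟩ := (hmem v).1 hv
      rwa [← hanti g hg h hh (hle'.trans hle)]
  rw [himage, Set.InjOn.ncard_image
    fun g hg h hh hgh => hanti h hh g hg (le_of_eq hgh), Set.ncard_coe_finset]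

variable (K m a) in
/-- The reduced Gröbner basis consists of the binomials `x^u - x^v` where `x^u` is a minimal
generator of the initial ideal and `x^v` its normal form. -/
lemma exists_isReducedGroebnerBasis :
    ∃ G : Finset (MvPolynomial (Fin n) K), IsReducedGroebnerBasis m (toricIdeal K a) G := by
  classical
  have hex : ∀ u : Fin n →₀ ℕ, ∃ v, v ∉ initialExponents m a ∧ aDegree a v = aDegree a u ∧
      (u ∈ initialExponents m a → v ≺[m] u) := by
    intro u
    obtain ⟨v, hdeg, hle, hstd⟩ := exists_notMem_initialExponents m a u
    refine ⟨v, hstd, hdeg, fun hu => lt_of_le_of_ne hle (m.toSyn.injective.ne ?_)⟩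
    rintro rfl
    exact hstd hu
  choose r hstd hdeg hlt using hex
  have hfin := finite_minimalInitialExponents (m := m) (a := a)
  have hdegree : ∀ u ∈ minimalInitialExponents m a,
      m.degree (monomial u (1 : K) - monomial (r u) 1) = u :=
    fun u hu => degree_monomial_sub_monomial (hlt u hu.prop)
  refine ⟨hfin.toFinset.image fun u => monomial u (1 : K) - monomial (r u) 1,
    ⟨?_, ?_⟩, ?_, ?_⟩
  · simp only [Finset.forall_mem_image]
    exact fun u _ => monomial_sub_monomial_mem_toricIdeal (hdeg u).symm
  · rw [initialIdeal_eq_span_minimal, Finset.coe_image, hfin.coe_toFinset, Set.image_image]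
    congr 1
    refine Set.image_congr fun u hu => ?_
    rw [MonomialOrder.leadingTerm, hdegree u hu,
      (monic_monomial_sub_monomial (hlt u hu.prop)).leadingCoeff_eq_one]
  · simp only [Finset.forall_mem_image, hfin.mem_toFinset]
    exact fun u hu => monic_monomial_sub_monomial (hlt u hu.prop)
  · simp only [Finset.forall_mem_image, hfin.mem_toFinset]
    intro u hu w hw hne d hd hle
    rw [hdegree w hw] at hle
    have hd' : d = u ∨ d = r u := by
      rcases Finset.mem_union.1 (support_sub (σ := Fin n) _ _ hd) with h | h
      · exact Or.inl (by simpa using support_monomial_subset h)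
      · exact Or.inr (by simpa using support_monomial_subset h)
    rcases hd' with rfl | rfl
    · exact hne (by rw [hu.eq_of_le hw.prop hle])
    · exact hstd u (initialExponents_mono hw.prop hle)

/-! ### Generators and height of the initial ideal -/

/-- Any generating set of the initial ideal has at least as many elements as there are minimal
monomial generators: the vector of the coefficients at the minimal exponents is multiplied by the
constant term of `g` when an element of the initial ideal is multiplied by `g`. -/
lemma ncard_minimalInitialExponents_le_card {s : Finset (MvPolynomial (Fin n) K)}
    (hs : Ideal.span (s : Set (MvPolynomial (Fin n) K)) = initialIdeal m (toricIdeal K a)) :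
    (minimalInitialExponents m a).ncard ≤ s.card := by
  classical
  have hfin := finite_minimalInitialExponents (m := m) (a := a)
  have : Fintype (minimalInitialExponents m a) := hfin.fintype
  let φ : MvPolynomial (Fin n) K →ₗ[K] (minimalInitialExponents m a → K) :=
    LinearMap.pi fun u => lcoeff K u.1
  have hφ : ∀ (f : MvPolynomial (Fin n) K) (u : minimalInitialExponents m a),
      φ f u = f.coeff u.1 := fun f u => rfl
  have hmul : ∀ g f : MvPolynomial (Fin n) K, f ∈ initialIdeal m (toricIdeal K a) →
      φ (g * f) = g.coeff 0 • φ f := by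
    intro g f hf
    funext u
    rw [Pi.smul_apply, hφ, hφ, coeff_mul, Finset.sum_eq_single (0, u.1), smul_eq_mul]
    · rintro ⟨p, q⟩ hpq hne
      rw [Finset.HasAntidiagonal.mem_antidiagonal] at hpq
      dsimp only at hpq ⊢
      by_cases hq : q ∈ f.support
      · have hqu : q = u.1 := u.2.eq_of_le (support_subset_initialExponents hf hq)
          (hpq ▸ le_add_self)
        have hp0 : p = 0 := by simpa [hqu] using hpq
        exact absurd (by rw [hp0, hqu]) hne
      · rw [notMem_support_iff.1 hq, mul_zero]
    · intro h
      simp at h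
  have hrange : ∀ f ∈ initialIdeal m (toricIdeal K a),
      φ f ∈ Submodule.span K ((s.image φ : Finset _) : Set (minimalInitialExponents m a → K)) := by
    intro f hf
    have hf' := hf
    rw [← hs] at hf'
    refine (Submodule.span_induction (p := fun f _ => φ f ∈ Submodule.span K
      ((s.image φ : Finset _) : Set (minimalInitialExponents m a → K))) ?_ ?_ ?_ ?_ hf')
    · intro x hx
      exact Submodule.subset_span (by simpa using ⟨x, hx, rfl⟩)
    · simp
    · intro x y _ _ hx hy
      rw [map_add]
      exact add_mem hx hy
    · intro g x hx hφx
      rw [smul_eq_mul, hmul g x (hs ▸ hx)]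
      exact Submodule.smul_mem _ _ hφx
  have htop : Submodule.span K
      ((s.image φ : Finset _) : Set (minimalInitialExponents m a → K)) = ⊤ := by
    rw [eq_top_iff, ← (Pi.basisFun K (minimalInitialExponents m a)).span_eq, Submodule.span_le]
    rintro _ ⟨u, rfl⟩
    have h1 := hrange _ (monomial_mem_initialIdeal_iff.2 u.2.prop)
    have h2 : Pi.basisFun K (minimalInitialExponents m a) u = φ (monomial u.1 1) := by
      funext v
      rw [hφ, coeff_monomial, Pi.basisFun_apply, Pi.single_apply]
      simp only [Subtype.ext_iff, eq_comm]
    rwa [SetLike.mem_coe, h2]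
  have hcard := finrank_span_finset_le_card (R := K) (s.image φ)
  rw [Set.finrank, htop, finrank_top, Module.finrank_fintype_fun_eq_card] at hcard
  rw [← Nat.card_coe_set_eq, Nat.card_eq_fintype_card]
  exact hcard.trans Finset.card_image_le

lemma isPrime_span_X_image (T : Set (Fin n)) :
    (Ideal.span (X '' T : Set (MvPolynomial (Fin n) K))).IsPrime := by
  classical
  -- The ideal is the kernel of the substitution `x_i ↦ 0` for `i ∈ T`.
  let ψ : MvPolynomial (Fin n) K →ₐ[K] MvPolynomial (Fin n) K :=
    aeval fun i => if i ∈ T then 0 else X i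
  have hker : Ideal.span (X '' T : Set (MvPolynomial (Fin n) K)) = RingHom.ker ψ := by
    refine le_antisymm (Ideal.span_le.2 ?_) fun f hf => ?_
    · rintro _ ⟨i, hi, rfl⟩
      simp [RingHom.mem_ker, ψ, hi]
    · have hsub : ∀ f, f - ψ f ∈ Ideal.span (X '' T : Set (MvPolynomial (Fin n) K)) := by
        intro f
        rw [← Ideal.Quotient.eq]
        have : (Ideal.Quotient.mkₐ K (Ideal.span (X '' T : Set (MvPolynomial (Fin n) K)))) =
            (Ideal.Quotient.mkₐ K _).comp ψ := by
          refine algHom_ext fun i => ?_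
          by_cases hi : i ∈ T
          · simp only [ψ, AlgHom.comp_apply, aeval_X, if_pos hi, map_zero]
            exact Ideal.Quotient.eq_zero_iff_mem.2 (Ideal.subset_span ⟨i, hi, rfl⟩)
          · simp only [ψ, AlgHom.comp_apply, aeval_X, if_neg hi]
        exact DFunLike.congr_fun this f
      have := hsub f
      rwa [RingHom.mem_ker.1 hf, sub_zero] at this
  rw [hker]
  exact RingHom.ker_isPrime _

lemma height_span_X_image (T : Finset (Fin n)) :
    (Ideal.span (X '' (T : Set (Fin n)) : Set (MvPolynomial (Fin n) K))).height = T.card := by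
  classical
  refine le_antisymm ?_ ?_
  · have := isPrime_span_X_image (K := K) (T : Set (Fin n))
    refine (Ideal.height_le_spanFinrank _ this.ne_top).trans (Nat.cast_le.2 ?_)
    refine (Submodule.spanFinrank_span_le_ncard_of_finite (T.finite_toSet.image X)).trans ?_
    refine (Set.ncard_image_le T.finite_toSet).trans ?_
    rw [Set.ncard_coe_finset]
  · induction T using Finset.induction_on with
    | empty => simp
    | insert i T hi ih =>
      have := isPrime_span_X_image (K := K) (T : Set (Fin n))
      have := isPrime_span_X_image (K := K) ((insert i T : Finset (Fin n)) : Set (Fin n))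
      have hlt : Ideal.span (X '' (T : Set (Fin n)) : Set (MvPolynomial (Fin n) K)) <
          Ideal.span (X '' ((insert i T : Finset (Fin n)) : Set (Fin n))) := by
        refine lt_of_le_of_ne (Ideal.span_mono (Set.image_mono (by simp))) fun he => ?_
        have hX : (X i : MvPolynomial (Fin n) K) ∈ Ideal.span (X '' (T : Set (Fin n))) := by
          rw [he]
          exact Ideal.subset_span ⟨i, by simp, rfl⟩
        rw [mem_ideal_span_X_image] at hX
        obtain ⟨j, hj, hne⟩ := hX (Finsupp.single i 1) (by simp [X])
        have hji : j ≠ i := by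
          rintro rfl
          exact hi hj
        exact hne (Finsupp.single_eq_of_ne hji)
      rw [Finset.card_insert_of_notMem hi, Nat.cast_add, Nat.cast_one]
      exact (add_le_add_left ih 1).trans (Ideal.height_add_one_le_of_lt_of_isPrime hlt)

/-- The radical of the initial ideal is generated by all variables but one. -/
lemma height_initialIdeal (ha : ∀ i, 0 < a i) (hn : 0 < n) (m : MonomialOrder (Fin n)) :
    initialIdeal m (toricIdeal K a) ≠ ⊤ ∧
      (initialIdeal m (toricIdeal K a)).height = ((n - 1 : ℕ) : ℕ∞) := by
  classical
  obtain ⟨k, hk, hpow⟩ := exists_variable_without_power ha hn m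
  have hP := isPrime_span_X_image (K := K) ((Finset.univ.erase k : Finset (Fin n)) : Set (Fin n))
  have hheight := height_span_X_image (K := K) (Finset.univ.erase k)
  rw [Finset.card_erase_of_mem (Finset.mem_univ k), Finset.card_univ, Fintype.card_fin] at hheight
  have hle : initialIdeal m (toricIdeal K a) ≤
      Ideal.span (X '' ((Finset.univ.erase k : Finset (Fin n)) : Set (Fin n))) := by
    intro f hf
    rw [mem_ideal_span_X_image]
    intro u hu
    by_contra! h
    refine hk (u k) ?_
    convert support_subset_initialExponents hf hu using 1
    ext j
    by_cases hj : j = k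
    · subst hj; simp
    · rw [Finsupp.single_eq_of_ne hj, h j (by simpa using hj)]
  refine ⟨ne_top_of_le_ne_top hP.ne_top hle, le_antisymm (hheight ▸ Ideal.height_mono hle) ?_⟩
  rw [Ideal.height_eq_inf_minimalPrimes]
  refine le_iInf₂ fun Q hQ => ?_
  have hQp := hQ.isPrime
  rw [← hheight]
  refine Ideal.height_mono (Ideal.span_le.2 ?_)
  rintro _ ⟨i, hi, rfl⟩
  obtain ⟨d, hd⟩ := hpow i (by simpa using hi)
  refine hQp.mem_of_pow_mem d (hQ.le ?_)
  rw [X_pow_eq_monomial]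
  exact monomial_mem_initialIdeal_iff.2 hd

lemma isCompleteIntersectionIdeal_iff (ha : ∀ i, 0 < a i) (hn : 0 < n)
    (m : MonomialOrder (Fin n)) :
    IsCompleteIntersectionIdeal (initialIdeal m (toricIdeal K a)) ↔
      (minimalInitialExponents m a).ncard = n - 1 := by
  classical
  obtain ⟨htop, hheight⟩ := height_initialIdeal (K := K) ha hn m
  constructor
  · rintro ⟨-, s, hs, hcard⟩
    rw [hheight, Nat.cast_inj] at hcard
    exact le_antisymm (hcard ▸ ncard_minimalInitialExponents_le_card hs)
      (minimalInitialExponents_card ha hn m).1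
  · intro h
    have hfin := finite_minimalInitialExponents (m := m) (a := a)
    refine ⟨htop, hfin.toFinset.image fun u => monomial u (1 : K), ?_, ?_⟩
    · rw [Finset.coe_image, hfin.coe_toFinset, ← initialIdeal_eq_span_minimal]
    · rw [hheight, Nat.cast_inj, Finset.card_image_of_injective _ fun u v huv =>
        monomial_left_injective one_ne_zero huv, ← Set.ncard_eq_toFinset_card _ hfin, h]

end

/-! ### The equivalences -/

theorem theorem3p9 (K : Type*) [Field K] (S : AddSubmonoid ℕ) (hS : IsNumericalSemigroup S)
    (n : ℕ) (a : Fin n → ℕ) (ha : Function.Injective a)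
    (hA : IsMinimalGeneratingSet S (Set.range a)) :
    (IsUniversallyFree S ↔
      ∀ (m : MonomialOrder.{0, 0} (Fin n)) (G : Finset (MvPolynomial (Fin n) K)),
        IsReducedGroebnerBasis m (toricIdeal K a) G → G.card = n - 1) ∧
    ((∀ (m : MonomialOrder.{0, 0} (Fin n)) (G : Finset (MvPolynomial (Fin n) K)),
        IsReducedGroebnerBasis m (toricIdeal K a) G → G.card = n - 1) ↔
      ∀ m : MonomialOrder.{0, 0} (Fin n),
        IsCompleteIntersectionIdeal (initialIdeal m (toricIdeal K a))) := by
  have hpos : ∀ i, 0 < a i := fun i => hA.pos (Set.mem_range_self i)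
  have hn : 0 < n := by
    refine Nat.pos_of_ne_zero ?_
    rintro rfl
    obtain ⟨A, hApos, hgcd, hcl⟩ := hS
    have hbot : S = ⊥ := by
      rw [← hA.1, Set.range_eq_empty, AddSubmonoid.closure_empty]
    obtain rfl : A = ∅ := by
      refine Finset.eq_empty_of_forall_notMem fun x hx => (hApos x hx).ne' ?_
      have : x ∈ S := hcl ▸ AddSubmonoid.subset_closure hx
      rwa [hbot, AddSubmonoid.mem_bot] at this
    simp at hgcd
  have hGB : (∀ (m : MonomialOrder.{0, 0} (Fin n)) (G : Finset (MvPolynomial (Fin n) K)),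
      IsReducedGroebnerBasis m (toricIdeal K a) G → G.card = n - 1) ↔
      ∀ m : MonomialOrder.{0, 0} (Fin n), (minimalInitialExponents m a).ncard = n - 1 := by
    refine forall_congr' fun m => ⟨fun h => ?_, fun h G hG => ?_⟩
    · obtain ⟨G, hG⟩ := exists_isReducedGroebnerBasis m a K
      rw [← card_of_isReducedGroebnerBasis hG, h G hG]
    · rw [card_of_isReducedGroebnerBasis hG, h]
  rw [hGB]
  refine ⟨?_, forall_congr' fun m => (isCompleteIntersectionIdeal_iff hpos hn m).symm⟩
  rw [isUniversallyFree_iff ha hA]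
  constructor
  · intro h m
    rw [(minimalInitialExponents_card hpos hn m).2]
    exact fun u hu =>
      eq_single_of_free hpos ((forall_perm_isFreeForArrangement_iff a).1 h) hu
  · intro h σ
    exact isFreeForArrangement_of_lexPerm hpos σ
      ((minimalInitialExponents_card hpos hn _).2.1 (h _))
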